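/- Let $p_0$ be a probability mass function (pmf) on $\mathbb N$ with support exactly $\{0,\dots,S\}$ for an integer $S>0$, and let $X_1,X_2,\dots$ be i.i.d. with pmf $p_0$. For $p:\mathbb N\to\mathbb R$ and $k\ge 1$ put $\Delta p(k)=p(k+1)-2p(k)+p(k-1)$ (and likewise for finite vectors); $p$ is convex on $\mathbb N$ if $\Delta p(k)\ge 0$ for all $k\ge1$, and $k\ge 1$ is a knot of $p$ if $\Delta p(k)>0$. For $n\ge 1$ let $p_n(j)=n^{-1}\sum_{i=1}^n \mathbf 1_{\{X_i=j\}}$, let $S_n=\max\{X_1,\dots,X_n\}$, and let $\hat p_n$ be the minimizer of $\sum_{j\in\mathbb N}(p_n(j)-p(j))^2$ over all convex pmfs $p$ on $\mathbb N$. Let $g_0$ be a centered Gaussian vector in $\mathbb R^{S+2}$ with covariances $\mathbf 1_{\{i=j\}}p_0(i)-p_0(i)p_0(j)$, $0\le i,j\le S+1$; let $\mathcal K_0$ be the set of $g=(g(0),\dots,g(S+1))\in\mathbb R^{S+2}$ with $\Delta g(k)\ge 0$ for every $k\in\{1,\dots,S\}$ that is not a knot of $p_0$; let $\hat g_0$ be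 the minimizer of $\sum_{k=0}^{S+1}(g(k)-g_0(k))^2$ over $g\in\mathcal K_0$, and $\hat T_0=\sum_{k=0}^{S+1}(\hat g_0(k)-g_0(k))^2$. Let $(v_n)$ be a sequence of positive numbers with $v_n\to 0$ and $n^{-1/2}=o(v_n)$. For each $n\ge1$ let $g_n$ be a random vector which, conditionally on $(X_1,\dots,X_n)$, is a centered Gaussian vector of dimension $S_n+2$ with covariances $\mathbf 1_{\{i=j\}}p_n(i)-p_n(i)p_n(j)$, $0\le i,j\le S_n+1$. Let $\mathcal K_n$ be the set of $g=(g(0),\dots,g(S_n+1))\in\mathbb R^{S_n+2}$ such that $\Delta g(x)\ge 0$ for all $x\in\{1,\dots,S_n\}$ with $\Delta\hat p_n(x)\le v_n$. Then for every $n\ge 1$ the minimizer $\hat g_n$ of $\sum_{k=0}^{S_n+1}(g(k)-g_n(k))^2$ over $g\in\mathcal K_n$ exists and is unique, and $\hat g_n$ and $\hat T_n=\sum_{k=0}^{S_n+1}(\hat g_n(k)-g_n(k))^2$ are measurable. Moreover, if $p_0$ is convex on $\mathbb N$, then conditionally on $X_1,\dots,X_n$, $\hat T_n$ converges in distribution to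 $\hat T_0$, in probability, as $n\to\infty$; that is, $E[f(\hat T_n)\mid X_1,\dots,X_n]\to E[f(\hat T_0)]$ in probability for every bounded continuous $f:\mathbb R\to\mathbb R$. -/

import Mathlib

open MeasureTheory ProbabilityTheory Filter Topology Asymptotics
open scoped BoundedContinuousFunction

noncomputable section

namespace ConvexTest

/-- The discrete second difference `Δp(k) = p(k+1) - 2p(k) + p(k-1)`, used for `k ≥ 1` only. -/
def secondDiff (p : ℕ → ℝ) (k : ℕ) : ℝ := p (k + 1) - 2 * p k + p (k - 1)

/-- `p` is a probability mass function on `ℕ`. -/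
def IsPmf (p : ℕ → ℝ) : Prop := (∀ j, 0 ≤ p j) ∧ HasSum p 1

/-- `p` is convex on `ℕ`. -/
def IsConvexSeq (p : ℕ → ℝ) : Prop := ∀ k, 1 ≤ k → 0 ≤ secondDiff p k

/-- `k ≥ 1` is a knot of `p` if `Δp(k) > 0`. -/
def IsKnot (p : ℕ → ℝ) (k : ℕ) : Prop := 1 ≤ k ∧ 0 < secondDiff p k

/-- The set of all convex probability mass functions on `ℕ`. -/
def convexPmfs : Set (ℕ → ℝ) := {p | IsPmf p ∧ IsConvexSeq p}

/-- `q` minimizes `∑_j (p(j) - r(j))²` over all convex probability mass functions `r`. -/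
def IsConvexLSE (p q : ℕ → ℝ) : Prop :=
  q ∈ convexPmfs ∧ IsMinOn (fun r : ℕ → ℝ => ∑' j, (p j - r j) ^ 2) convexPmfs q

/-- The convex least-squares estimator: the minimizer of `‖p - r‖²` over all convex probability
mass functions `r`. -/
def convexLSE (p : ℕ → ℝ) : ℕ → ℝ := Classical.epsilon (IsConvexLSE p)

/-- The empirical probability mass function of a sample of size `n`. -/
def empPmf {n : ℕ} (x : Fin n → ℕ) (j : ℕ) : ℝ :=
  (n : ℝ)⁻¹ * ∑ i, if x i = j then (1 : ℝ) else 0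

/-- The largest value in the sample. -/
def sampleMax {n : ℕ} (x : Fin n → ℕ) : ℕ := Finset.univ.sup x

/-- Real vectors `(g(0), …, g(s+1))`. -/
abbrev Vec (s : ℕ) : Type := EuclideanSpace ℝ (Fin (s + 2))

/-- The matrix with entries `1_{i = j} p(i) - p(i) p(j)` for `i, j = 0, …, s + 1`. -/
def covMatrix (s : ℕ) (p : ℕ → ℝ) : Matrix (Fin (s + 2)) (Fin (s + 2)) ℝ :=
  Matrix.of fun i j => (if i = j then p i else 0) - p i * p j

/-- The second difference `g(x+1) - 2g(x) + g(x-1)` of a vector at `x = k + 1`, so that `x` runs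
through `{1, …, s}`. -/
def vecSecondDiff {s : ℕ} (g : Vec s) (k : Fin s) : ℝ :=
  g k.succ.succ - 2 * g k.succ.castSucc + g k.castSucc.castSucc

/-- The vectors `(g(0), …, g(s+1))` with `Δg(x) ≥ 0` for every `x ∈ {1, …, s}` that lies in `A`. -/
def convexOnPoints (s : ℕ) (A : Set ℕ) : Set (Vec s) :=
  {g | ∀ k : Fin s, (k : ℕ) + 1 ∈ A → 0 ≤ vecSecondDiff g k}

/-- `∑_k (h(k) - u(k))²`. -/
def sqDist {s : ℕ} (h u : Vec s) : ℝ := ∑ k, (h k - u k) ^ 2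

/-- `h` minimizes `∑_k (g(k) - u(k))²` over `g ∈ K`. -/
def IsProj {s : ℕ} (K : Set (Vec s)) (u h : Vec s) : Prop :=
  h ∈ K ∧ IsMinOn (fun g => sqDist g u) K h

/-- The minimizer of `∑_k (g(k) - u(k))²` over `g ∈ K`. -/
def proj {s : ℕ} (K : Set (Vec s)) (u : Vec s) : Vec s := Classical.epsilon (IsProj K u)

/-- The vectors on `{0, …, S+1}` that are convex at every point of `{1, …, S}`, with possible
exceptions at the knots of `p`. -/
def coneZero (S : ℕ) (p : ℕ → ℝ) : Set (Vec S) := convexOnPoints S {x | ¬ IsKnot p x}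

/-- The vectors on `{0, …, S_n+1}` that are convex at every `x ∈ {1, …, S_n}` at which the convex
least-squares estimator has second difference at most `v`. -/
def coneEmp {n : ℕ} (v : ℝ) (x : Fin n → ℕ) : Set (Vec (sampleMax x)) :=
  convexOnPoints (sampleMax x) {k | secondDiff (convexLSE (empPmf x)) k ≤ v}

/-- Vectors of varying dimension: the disjoint union of the spaces `ℝ^{s+2}`, with the
disjoint-union σ-algebra. Random vectors of random dimension take their values here. -/
abbrev VarVec : Type := (s : ℕ) × Vec s

/-- The first `n` observations. -/
def sample {Ω : Type*} (X : ℕ → Ω → ℕ) (n : ℕ) (ω : Ω) : Fin n → ℕ := fun i => X i ω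

/-- Conditionally on the σ-algebras `m n`, the real random variables `T n` converge in distribution
to `T₀`, in probability: `E[f(T n) | m n] → E[f(T₀)]` in probability for all bounded continuous `f`.
-/
def CondTendstoInDistribution {Ω Ω₀ : Type*} [MeasurableSpace Ω] [MeasurableSpace Ω₀]
    (P : Measure Ω) (P₀ : Measure Ω₀) (m : ℕ → MeasurableSpace Ω) (T : ℕ → Ω → ℝ)
    (T₀ : Ω₀ → ℝ) : Prop :=
  ∀ f : ℝ →ᵇ ℝ, TendstoInMeasure P (fun n => P[fun ω => f (T n ω) | m n]) atTop
    (fun _ => ∫ ω, f (T₀ ω) ∂P₀)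

end ConvexTest

end

/-! Given the data, the law of the statistic depends only on the sample maximum, the covariance
built from the empirical pmf, and the set of points where convexity is imposed. With probability
tending to one the maximum equals `S` and the imposed constraints cut out `coneZero S p₀`. The
statistic is then one fixed continuous function of a Gaussian vector, and only the covariance still
varies, converging to that of `g₀`.

The cone is recovered because nearest-point maps onto convex sets are nonexpansive
(`norm_sub_le_of_forall_norm_le`). A convex `p₀` is its own nearest point, so the estimator is no
farther from `p₀` in ℓ² than the empirical pmf, whose error is of order n^(-1/2) = o(`v n`) by
Chebyshev. Hence, with high probability, the second differences of the estimator are within `v n` of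
those of `p₀`: at most `v n` at non-knots, where `p₀` has second difference zero, and above `v n` at
knots once `v n` is small (`convexOnPoints_convexLSE_eq_coneZero`). Nonexpansiveness also makes the
statistic continuous in the Gaussian vector.

A sample takes countably many values, so conditional expectations are averages over fibres
(`condExp_comap_ae_eq`). These are Gaussian integrals, stable under small changes of the pmf
(`exists_pos_abs_integral_gaussian_sub_lt`). Existence of the estimator needs its own argument,
since the convex pmfs are not closed in ℓ². -/

namespace ConvexTest

/-! ### Minimal distance to convex sets -/

section Hilbert

variable {F : Type*} [NormedAddCommGroup F] [InnerProductSpace ℝ F]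

lemma inner_le_zero_of_forall_norm_le {K : Set F} (hK : Convex ℝ K) {u v : F} (hv : v ∈ K)
    (h : ∀ w ∈ K, ‖u - v‖ ≤ ‖u - w‖) : ∀ w ∈ K, inner ℝ (u - v) (w - v) ≤ 0 := by
  have : Nonempty K := ⟨⟨v, hv⟩⟩
  refine (norm_eq_iInf_iff_real_inner_le_zero hK hv).1 (le_antisymm ?_ ?_)
  · exact le_ciInf fun w => h w w.2
  · exact ciInf_le (f := fun w : K => ‖u - w‖)
      ⟨0, Set.forall_mem_range.2 fun _ => norm_nonneg _⟩ ⟨v, hv⟩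

lemma exists_forall_norm_le {K : Set F} (hne : K.Nonempty) (hc : IsComplete K)
    (hK : Convex ℝ K) (u : F) : ∃ v ∈ K, ∀ w ∈ K, ‖u - v‖ ≤ ‖u - w‖ := by
  obtain ⟨v, hv, h⟩ := exists_norm_eq_iInf_of_complete_convex hne hc hK u
  refine ⟨v, hv, fun w hw => h.le.trans ?_⟩
  exact ciInf_le (f := fun w : K => ‖u - w‖)
      ⟨0, Set.forall_mem_range.2 fun _ => norm_nonneg _⟩ ⟨w, hw⟩

/-- The metric projection onto a convex set does not increase distances. -/
lemma norm_sub_le_of_forall_norm_le {K : Set F} (hK : Convex ℝ K) {u v u' v' : F} (hv : v ∈ K)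
    (h : ∀ w ∈ K, ‖u - v‖ ≤ ‖u - w‖) (hv' : v' ∈ K) (h' : ∀ w ∈ K, ‖u' - v'‖ ≤ ‖u' - w‖) :
    ‖v - v'‖ ≤ ‖u - u'‖ := by
  have h1 := inner_le_zero_of_forall_norm_le hK hv h v' hv'
  have h2 := inner_le_zero_of_forall_norm_le hK hv' h' v hv
  -- The two variational inequalities add up to this bound; Cauchy–Schwarz then finishes.
  have h3 : ‖v - v'‖ * ‖v - v'‖ ≤ inner ℝ (u - u') (v - v') := by
    rw [← real_inner_self_eq_norm_mul_norm]
    have e1 : inner ℝ (u - v) (v' - v) = - inner ℝ (u - v) (v - v') := by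
      rw [← inner_neg_right, neg_sub]
    have e2 : inner ℝ (u - u') (v - v') = inner ℝ (u - v) (v - v') + inner ℝ (v - v') (v - v') -
        inner ℝ (u' - v') (v - v') := by
      rw [← inner_add_left, ← inner_sub_left]; congr 1; abel
    linarith
  have h4 := h3.trans (real_inner_le_norm _ _)
  by_contra! hlt
  have : 0 < ‖v - v'‖ := (norm_nonneg _).trans_lt hlt
  nlinarith

end Hilbert

/-! ### Projections onto cones of partially convex vectors -/

section Cone

variable {s : ℕ}

lemma sqDist_eq_norm_sq (h u : Vec s) : sqDist h u = ‖u - h‖ ^ 2 := by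
  rw [norm_sub_rev, EuclideanSpace.real_norm_sq_eq]; rfl

lemma isProj_iff {K : Set (Vec s)} {u h : Vec s} :
    IsProj K u h ↔ h ∈ K ∧ ∀ w ∈ K, ‖u - h‖ ≤ ‖u - w‖ := by
  simp only [IsProj, isMinOn_iff, sqDist_eq_norm_sq, sq_le_sq, abs_norm]

lemma convex_convexOnPoints (s : ℕ) (A : Set ℕ) : Convex ℝ (convexOnPoints s A) := by
  intro f hf g hg a b ha hb _ k hk
  have e : vecSecondDiff (a • f + b • g) k = a * vecSecondDiff f k + b * vecSecondDiff g k := by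
    simp [vecSecondDiff]; ring
  rw [e]
  exact add_nonneg (mul_nonneg ha (hf k hk)) (mul_nonneg hb (hg k hk))

lemma isClosed_convexOnPoints (s : ℕ) (A : Set ℕ) : IsClosed (convexOnPoints s A) := by
  simp only [convexOnPoints, Set.ofPred_forall]
  refine isClosed_iInter fun k => isClosed_iInter fun _ => isClosed_le continuous_const ?_
  unfold vecSecondDiff
  fun_prop

lemma existsUnique_isProj (A : Set ℕ) (u : Vec s) : ∃! h, IsProj (convexOnPoints s A) u h := by
  obtain ⟨h, hh⟩ := exists_forall_norm_le
    (⟨0, fun k _ => by simp [vecSecondDiff]⟩ : (convexOnPoints s A).Nonempty)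
    (isClosed_convexOnPoints s A).isComplete (convex_convexOnPoints s A) u
  refine ⟨h, isProj_iff.2 hh, fun h' hh' => ?_⟩
  replace hh' := isProj_iff.1 hh'
  have := norm_sub_le_of_forall_norm_le (convex_convexOnPoints s A) hh'.1 hh'.2 hh.1 hh.2
  simpa [sub_eq_zero] using this

lemma isProj_proj (A : Set ℕ) (u : Vec s) :
    IsProj (convexOnPoints s A) u (proj (convexOnPoints s A) u) :=
  Classical.epsilon_spec (existsUnique_isProj A u).exists

lemma continuous_proj (s : ℕ) (A : Set ℕ) : Continuous (proj (convexOnPoints s A)) := by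
  refine (LipschitzWith.of_dist_le_mul (K := 1) fun u u' => ?_).continuous
  have h := isProj_iff.1 (isProj_proj A u)
  have h' := isProj_iff.1 (isProj_proj A u')
  simpa [dist_eq_norm] using
    norm_sub_le_of_forall_norm_le (convex_convexOnPoints s A) h.1 h.2 h'.1 h'.2

lemma continuous_sqDist_proj (s : ℕ) (A : Set ℕ) :
    Continuous fun u : Vec s => sqDist (proj (convexOnPoints s A) u) u := by
  simp only [sqDist_eq_norm_sq]
  have := continuous_proj s A
  fun_prop

lemma convexOnPoints_congr {A B : Set ℕ}
    (h : ∀ k, 1 ≤ k → k ≤ s → (k ∈ A ↔ k ∈ B)) : convexOnPoints s A = convexOnPoints s B := by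
  ext g
  simp only [convexOnPoints, Set.mem_ofPred_eq]
  exact forall_congr' fun k => imp_congr_left (h _ (by omega) (by omega))

end Cone

/-! ### The convex least-squares estimator -/

section LSE

/-- Square-summable real sequences. -/
abbrev L2Seq : Type := lp (fun _ : ℕ => ℝ) 2

lemma IsPmf.memℓp {p : ℕ → ℝ} (hp : IsPmf p) : Memℓp p 2 := by
  have h1 : Memℓp p 1 := by
    rw [memℓp_gen_iff (by simp)]
    simpa [abs_of_nonneg (hp.1 _)] using hp.2.summable
  exact h1.of_exponent_ge (by norm_num)

/-- A probability mass function as a square-summable sequence. -/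
def IsPmf.toL2 {p : ℕ → ℝ} (hp : IsPmf p) : L2Seq := ⟨p, hp.memℓp⟩

lemma hasSum_norm_sub_sq (f g : L2Seq) : HasSum (fun j => (f j - g j) ^ 2) (‖f - g‖ ^ 2) := by
  rw [← real_inner_self_eq_norm_sq]
  have h := lp.hasSum_inner (𝕜 := ℝ) (f - g) (f - g)
  simpa [Pi.sub_apply, pow_two] using h

lemma isPmf_tsum_sub_sq {p r : ℕ → ℝ} (hp : IsPmf p) (hr : IsPmf r) :
    ∑' j, (p j - r j) ^ 2 = ‖hp.toL2 - hr.toL2‖ ^ 2 :=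
  (hasSum_norm_sub_sq hp.toL2 hr.toL2).tsum_eq

lemma continuous_coord (j : ℕ) : Continuous fun f : L2Seq => f j :=
  (lp.evalCLM ℝ (fun _ : ℕ => ℝ) 2 j).continuous

/-- Square-summable, nonnegative, convex sequences of total mass at most one. -/
def convexSubPmfs : Set L2Seq :=
  {f | (∀ j, 0 ≤ f j) ∧ IsConvexSeq f ∧ ∀ N, ∑ j ∈ Finset.range N, f j ≤ 1}

/-- Mass can escape in ℓ²: normalized tents of growing width tend to 0. Bounding partial sums by
one, instead of fixing the total, leaves only closed conditions on finitely many coordinates each.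
-/
lemma isClosed_convexSubPmfs : IsClosed convexSubPmfs := by
  have hc : ∀ j, Continuous fun f : L2Seq => (f j : ℝ) := continuous_coord
  simp only [convexSubPmfs, IsConvexSeq, Set.ofPred_and, Set.ofPred_forall, secondDiff]
  refine (isClosed_iInter fun j => isClosed_le continuous_const (hc j)).inter
    ((isClosed_iInter fun k => isClosed_iInter fun _ => isClosed_le continuous_const ?_).inter
      (isClosed_iInter fun N => isClosed_le ?_ continuous_const))
  · exact Continuous.add (Continuous.sub (hc _) (continuous_const.mul (hc _))) (hc _)
  · exact continuous_finsetSum _ fun j _ => hc j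

lemma IsConvexSeq.combo {f g : ℕ → ℝ} (hf : IsConvexSeq f) (hg : IsConvexSeq g) {a b : ℝ}
    (ha : 0 ≤ a) (hb : 0 ≤ b) : IsConvexSeq fun j => a * f j + b * g j := by
  intro k hk
  have e : secondDiff (fun j => a * f j + b * g j) k = a * secondDiff f k + b * secondDiff g k := by
    simp [secondDiff]; ring
  rw [e]
  exact add_nonneg (mul_nonneg ha (hf k hk)) (mul_nonneg hb (hg k hk))

lemma coe_combo (f g : L2Seq) (a b : ℝ) : ⇑(a • f + b • g) = fun j => a * f j + b * g j := by
  rfl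

lemma convex_convexSubPmfs : Convex ℝ convexSubPmfs := by
  rintro f ⟨hf0, hfc, hfs⟩ g ⟨hg0, hgc, hgs⟩ a b ha hb hab
  refine ⟨fun j => ?_, ?_, fun N => ?_⟩
  · rw [coe_combo]; exact add_nonneg (mul_nonneg ha (hf0 j)) (mul_nonneg hb (hg0 j))
  · rw [coe_combo]; exact hfc.combo hgc ha hb
  · rw [coe_combo, Finset.sum_add_distrib, ← Finset.mul_sum, ← Finset.mul_sum]
    nlinarith [mul_le_mul_of_nonneg_left (hfs N) ha, mul_le_mul_of_nonneg_left (hgs N) hb]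

lemma mem_convexSubPmfs_of_mem {p : ℕ → ℝ} (hp : IsPmf p) (hc : IsConvexSeq p) :
    hp.toL2 ∈ convexSubPmfs :=
  ⟨hp.1, hc, fun _ => sum_le_hasSum _ (fun j _ => hp.1 j) hp.2⟩

/-- The tent `j ↦ max 0 (1 - j / m)`. -/
noncomputable def tent (m j : ℕ) : ℝ := max 0 (1 - (j : ℝ) / m)

lemma tent_nonneg (m j : ℕ) : 0 ≤ tent m j := le_max_left _ _

lemma tent_le_one (m j : ℕ) : tent m j ≤ 1 :=
  max_le zero_le_one (sub_le_self _ (by positivity))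

lemma tent_eq_zero {m j : ℕ} (hm : 0 < m) (h : m ≤ j) : tent m j = 0 := by
  refine max_eq_left ?_
  have : (1 : ℝ) ≤ j / m := by
    rw [le_div_iff₀ (by exact_mod_cast hm)]; simpa using h
  linarith

/-- A maximum of two affine functions is convex: the middle value is attained by one of them, which
stays below the maximum at both neighbours. -/
lemma isConvexSeq_tent (m : ℕ) : IsConvexSeq (tent m) := by
  intro k hk
  obtain ⟨k, rfl⟩ : ∃ l, k = l + 1 := ⟨k - 1, by omega⟩
  simp only [secondDiff, tent, Nat.add_sub_cancel]
  push_cast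
  have e : 2 * (1 - ((k : ℝ) + 1) / m) = (1 - ((k : ℝ) + 1 + 1) / m) + (1 - (k : ℝ) / m) := by ring
  rcases max_cases (0 : ℝ) (1 - ((k : ℝ) + 1) / m) with h | h <;>
  linarith [le_max_left (0 : ℝ) (1 - ((k : ℝ) + 1 + 1) / m), le_max_left (0 : ℝ) (1 - (k : ℝ) / m),
    le_max_right (0 : ℝ) (1 - ((k : ℝ) + 1 + 1) / m), le_max_right (0 : ℝ) (1 - (k : ℝ) / m)]

lemma sum_tent_le {m : ℕ} (hm : 0 < m) (N : ℕ) : ∑ j ∈ Finset.range N, tent m j ≤ m := by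
  calc ∑ j ∈ Finset.range N, tent m j ≤ ∑ j ∈ Finset.range N, if j < m then (1 : ℝ) else 0 := by
        refine Finset.sum_le_sum fun j _ => ?_
        split_ifs with h
        · exact tent_le_one m j
        · exact (tent_eq_zero hm (not_lt.1 h)).le
    _ ≤ m := by
        rw [Finset.sum_ite, Finset.sum_const_zero, add_zero, Finset.sum_const, nsmul_one]
        have : (Finset.range N).filter (· < m) ⊆ Finset.range m := fun j hj => by
          simp at hj ⊢; exact hj.2
        exact_mod_cast (Finset.card_le_card this).trans (Finset.card_range m).le

lemma memℓp_tent {m : ℕ} (hm : 0 < m) : Memℓp (tent m) 2 := by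
  rw [memℓp_gen_iff (by simp)]
  refine summable_of_ne_finset_zero (s := Finset.range m) fun j hj => ?_
  rw [tent_eq_zero hm (by simpa using hj)]
  simp

lemma tendsto_tent (j : ℕ) : Tendsto (fun m => tent m j) atTop (𝓝 1) := by
  have h : Tendsto (fun m : ℕ => max 0 (1 - (j : ℝ) / m)) atTop (𝓝 (max 0 (1 - 0))) :=
    (tendsto_const_nhds).max (tendsto_const_nhds.sub (tendsto_const_div_atTop_nhds_zero_nat _))
  simpa [tent] using h

/-- Minimizing over convex sequences of mass at most one yields a sequence of mass one. -/
lemma hasSum_one_of_minimizer {p : ℕ → ℝ} (hp : IsPmf p) {q : L2Seq} (hq : q ∈ convexSubPmfs)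
    (hmin : ∀ w ∈ convexSubPmfs, ‖hp.toL2 - q‖ ≤ ‖hp.toL2 - w‖) : HasSum q 1 := by
  obtain ⟨hq0, hqc, hqs⟩ := id hq
  have hsum : Summable q := summable_of_sum_range_le hq0 hqs
  have hle : ∑' j, q j ≤ 1 := Real.tsum_le_of_sum_range_le hq0 hqs
  set t := ∑' j, q j with ht
  rcases hle.eq_or_lt with h | hlt
  · rw [← h]; exact hsum.hasSum
  exfalso
  -- If `q` has mass `t < 1`, then adding `(1 - t) / m` times a tent, whose mass is at most `m`,
  -- stays in the set. The variational inequality in that direction gives the claim.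
  have key : ∀ m : ℕ, 0 < m → ∑' j, tent m j * (p j - q j) ≤ 0 := by
    intro m hm
    have hm' : (0 : ℝ) < m := by exact_mod_cast hm
    set U : L2Seq := ⟨tent m, memℓp_tent hm⟩
    set ε : ℝ := (1 - t) / m
    have hε : 0 < ε := div_pos (sub_pos.2 hlt) hm'
    have hw : q + ε • U ∈ convexSubPmfs := by
      have e : ⇑(q + ε • U) = fun j => 1 * q j + ε * tent m j := by
        simp only [one_mul]; rfl
      refine ⟨fun j => ?_, ?_, fun N => ?_⟩
      · rw [e]; exact add_nonneg (by simpa using hq0 j) (mul_nonneg hε.le (tent_nonneg m j))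
      · rw [e]; exact hqc.combo (isConvexSeq_tent m) zero_le_one hε.le
      · rw [e, Finset.sum_add_distrib, ← Finset.mul_sum, ← Finset.mul_sum]
        have h1 : ∑ j ∈ Finset.range N, q j ≤ t := hsum.sum_le_tsum _ fun j _ => hq0 j
        have h2 := mul_le_mul_of_nonneg_left (sum_tent_le hm N) hε.le
        have h3 : ε * m = 1 - t := div_mul_cancel₀ _ hm'.ne'
        linarith
    have hin := inner_le_zero_of_forall_norm_le convex_convexSubPmfs hq hmin _ hw
    rw [add_sub_cancel_left, inner_smul_right, lp.inner_eq_tsum] at hin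
    have := nonpos_of_mul_nonpos_right hin hε
    exact (tsum_congr fun _ => rfl).trans_le this
  -- The tents increase to the constant 1, so in the limit the mass of `p` minus that of `q` is
  -- nonpositive, contradicting `t < 1`.
  have hlim : Tendsto (fun m => ∑' j, tent m j * (p j - q j)) atTop
      (𝓝 (∑' j, 1 * (p j - q j))) := by
    refine tendsto_tsum_of_dominated_convergence (bound := fun j => p j + q j)
      (hp.2.summable.add hsum) (fun j => (tendsto_tent j).mul_const _) (.of_forall fun m j => ?_)
    rw [norm_mul, Real.norm_of_nonneg (tent_nonneg m j), Real.norm_eq_abs]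
    have h1 : |p j - q j| ≤ p j + q j := by
      rw [abs_le]; constructor <;> linarith [hp.1 j, hq0 j]
    exact (mul_le_of_le_one_left (abs_nonneg _) (tent_le_one m j)).trans h1
  have h0 : ∑' j, 1 * (p j - q j) ≤ 0 :=
    le_of_tendsto hlim ((eventually_gt_atTop 0).mono fun m hm => key m hm)
  simp only [one_mul] at h0
  rw [hp.2.summable.tsum_sub hsum, hp.2.tsum_eq] at h0
  linarith

/-- The minimizer over the larger closed set has mass one, so it is itself a convex pmf, and a
fortiori minimal among them. -/
lemma exists_isConvexLSE {p : ℕ → ℝ} (hp : IsPmf p) : ∃ q, IsConvexLSE p q := by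
  have hne : convexSubPmfs.Nonempty :=
    ⟨0, fun j => by simp, fun k _ => by simp [secondDiff], fun _ => by simp⟩
  obtain ⟨q, hq, hmin⟩ := exists_forall_norm_le hne isClosed_convexSubPmfs.isComplete
    convex_convexSubPmfs hp.toL2
  have hqp : IsPmf q := ⟨hq.1, hasSum_one_of_minimizer hp hq hmin⟩
  refine ⟨q, ⟨hqp, hq.2.1⟩, isMinOn_iff.2 fun r hr => ?_⟩
  rw [isPmf_tsum_sub_sq hp hqp, isPmf_tsum_sub_sq hp hr.1]
  exact pow_le_pow_left₀ (norm_nonneg _) (hmin _ (mem_convexSubPmfs_of_mem hr.1 hr.2)) 2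

lemma isConvexLSE_convexLSE {p : ℕ → ℝ} (hp : IsPmf p) : IsConvexLSE p (convexLSE p) :=
  Classical.epsilon_spec (exists_isConvexLSE hp)

/-- The convex least-squares estimator is at least as close to a convex pmf as the data. -/
lemma tsum_convexLSE_sub_sq_le {p p₀ : ℕ → ℝ} (hp : IsPmf p) (hp₀ : IsPmf p₀)
    (hc : IsConvexSeq p₀) :
    Summable (fun j => (convexLSE p j - p₀ j) ^ 2) ∧
      ∑' j, (convexLSE p j - p₀ j) ^ 2 ≤ ∑' j, (p j - p₀ j) ^ 2 := by
  obtain ⟨⟨hq, hqc⟩, hmin⟩ := isConvexLSE_convexLSE hp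
  rw [isMinOn_iff] at hmin
  refine ⟨(hasSum_norm_sub_sq hq.toL2 hp₀.toL2).summable, ?_⟩
  rw [isPmf_tsum_sub_sq hq hp₀, isPmf_tsum_sub_sq hp hp₀]
  refine pow_le_pow_left₀ (norm_nonneg _) ?_ 2
  set K : Set L2Seq := {f | ⇑f ∈ convexPmfs}
  have hK : Convex ℝ K := by
    intro f hf g hg a b ha hb hab
    simp only [K, Set.mem_ofPred_eq] at hf hg ⊢
    rw [coe_combo]
    refine ⟨⟨fun j => add_nonneg (mul_nonneg ha (hf.1.1 j)) (mul_nonneg hb (hg.1.1 j)), ?_⟩,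
      hf.2.combo hg.2 ha hb⟩
    simpa [hab] using (hf.1.2.mul_left a).add (hg.1.2.mul_left b)
  -- Nonexpansiveness uses only that both points are minimizers, so `K` need not be closed; `p₀`
  -- lies in `K` and is its own nearest point.
  refine norm_sub_le_of_forall_norm_le hK (show hq.toL2 ∈ K from ⟨hq, hqc⟩) (fun w hw => ?_)
    (show hp₀.toL2 ∈ K from ⟨hp₀, hc⟩) (fun w _ => by simp)
  have h := hmin w hw
  rw [isPmf_tsum_sub_sq hp hq, isPmf_tsum_sub_sq hp hw.1] at h
  exact le_of_sq_le_sq h (norm_nonneg _)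

/-- A coordinate error is at most the ℓ² error, and the squared ℓ² error of `p` has at most `S + 1`
nonzero terms, each at most `c ^ 2`. The resulting factor √(S + 1) is relaxed to `S + 1`. -/
lemma abs_convexLSE_sub_le {p p₀ : ℕ → ℝ} (hp : IsPmf p) (hp₀ : IsPmf p₀)
    (hc : IsConvexSeq p₀) {S : ℕ} {c : ℝ} (hle : ∀ j ≤ S, |p j - p₀ j| ≤ c)
    (heq : ∀ j, S < j → p j = p₀ j) (j : ℕ) : |convexLSE p j - p₀ j| ≤ (S + 1) * c := by
  obtain ⟨hs, h⟩ := tsum_convexLSE_sub_sq_le hp hp₀ hc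
  have hc0 : 0 ≤ c := (abs_nonneg _).trans (hle 0 (Nat.zero_le _))
  have h1 := (hs.le_tsum j fun _ _ => sq_nonneg _).trans h
  rw [tsum_eq_sum (s := Finset.range (S + 1)) fun i hi => by
    rw [heq i (by simpa using hi)]; simp] at h1
  have h2 : ∑ i ∈ Finset.range (S + 1), (p i - p₀ i) ^ 2 ≤ (S + 1) * c ^ 2 := by
    refine (Finset.sum_le_card_nsmul _ _ (c ^ 2) fun i hi => ?_).trans (by simp)
    rw [← sq_abs]
    exact pow_le_pow_left₀ (abs_nonneg _) (hle i (by simpa [Nat.lt_succ_iff] using hi)) 2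
  refine abs_le_of_sq_le_sq ?_ (by positivity)
  refine h1.trans (h2.trans ?_)
  have : (0 : ℝ) ≤ S := Nat.cast_nonneg S
  have : 0 ≤ (S : ℝ) * (S + 1) * c ^ 2 := by positivity
  nlinarith

lemma abs_secondDiff_sub_le {p q : ℕ → ℝ} {c : ℝ} (h : ∀ j, |p j - q j| ≤ c) (k : ℕ) :
    |secondDiff p k - secondDiff q k| ≤ 4 * c := by
  have h1 := abs_le.1 (h (k + 1))
  have h2 := abs_le.1 (h k)
  have h3 := abs_le.1 (h (k - 1))
  rw [abs_le]
  unfold secondDiff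
  constructor <;> linarith

end LSE

end ConvexTest

namespace ConvexTest

/-! ### Gaussian vectors with multinomial covariance -/

section Gaussian

variable {s : ℕ}

lemma IsPmf.sum_fin_le {p : ℕ → ℝ} (hp : IsPmf p) (m : ℕ) : ∑ i : Fin m, p i ≤ 1 := by
  rw [Fin.sum_univ_eq_sum_range p]
  exact sum_le_hasSum _ (fun j _ => hp.1 j) hp.2

/-- This variance-like form gives both the positivity of the matrix and the exponent of the
characteristic function. -/
lemma dotProduct_covMatrix_mulVec (s : ℕ) (p : ℕ → ℝ) (x : Fin (s + 2) → ℝ) :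
    x ⬝ᵥ (covMatrix s p).mulVec x = ∑ i : Fin (s + 2), p i * x i ^ 2 -
      (∑ i : Fin (s + 2), p i * x i) ^ 2 := by
  have e : ∀ i, (covMatrix s p).mulVec x i = p i * x i -
      p i * ∑ j : Fin (s + 2), p j * x j := by
    intro i
    simp only [covMatrix, Matrix.mulVec, dotProduct, Matrix.of_apply, sub_mul,
      Finset.sum_sub_distrib, ite_mul, zero_mul, Finset.sum_ite_eq, Finset.mem_univ, if_true,
      Finset.mul_sum, mul_assoc]
  simp only [dotProduct, e, mul_sub, Finset.sum_sub_distrib]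
  congr 1
  · exact Finset.sum_congr rfl fun i _ => by ring
  · rw [pow_two, Finset.sum_mul]
    exact Finset.sum_congr rfl fun i _ => by ring

lemma posSemidef_covMatrix {p : ℕ → ℝ} (hp : IsPmf p) (s : ℕ) : (covMatrix s p).PosSemidef := by
  refine Matrix.PosSemidef.of_dotProduct_mulVec_nonneg ?_ fun x => ?_
  · ext i j
    by_cases h : i = j
    · subst h; simp [covMatrix]
    · simp [covMatrix, h, Ne.symm h, mul_comm]
  · rw [star_trivial, dotProduct_covMatrix_mulVec, sub_nonneg]
    -- Cauchy–Schwarz with weights `p i`, whose truncated sum is at most one.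
    have h1 : (∑ i : Fin (s + 2), p i * x i) ^ 2 ≤
        (∑ i : Fin (s + 2), p i) * ∑ i : Fin (s + 2), p i * x i ^ 2 :=
      Finset.sum_sq_le_sum_mul_sum_of_sq_le_mul _ (fun i _ => hp.1 i)
        (fun i _ => mul_nonneg (hp.1 i) (sq_nonneg _)) fun i _ => le_of_eq (by ring)
    have h2 : 0 ≤ ∑ i : Fin (s + 2), p i * x i ^ 2 :=
      Finset.sum_nonneg fun i _ => mul_nonneg (hp.1 i) (sq_nonneg _)
    exact h1.trans (mul_le_of_le_one_left h2 (hp.sum_fin_le _))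

/-- Lévy's continuity theorem: the characteristic function depends continuously on finitely many
values of the pmf. -/
lemma tendsto_integral_gaussian {p : ℕ → ℕ → ℝ} {p₀ : ℕ → ℝ} (hp : ∀ n, IsPmf (p n))
    (hp₀ : IsPmf p₀) (h : ∀ j < s + 2, Tendsto (fun n => p n j) atTop (𝓝 (p₀ j)))
    (f : Vec s →ᵇ ℝ) :
    Tendsto (fun n => ∫ u, f u ∂multivariateGaussian 0 (covMatrix s (p n))) atTop
      (𝓝 (∫ u, f u ∂multivariateGaussian 0 (covMatrix s p₀))) := by
  let μ : ℕ → ProbabilityMeasure (Vec s) := fun n =>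
    ⟨multivariateGaussian 0 (covMatrix s (p n)), inferInstance⟩
  let μ₀ : ProbabilityMeasure (Vec s) := ⟨multivariateGaussian 0 (covMatrix s p₀), inferInstance⟩
  have hμ : Tendsto μ atTop (𝓝 μ₀) := by
    refine ProbabilityMeasure.tendsto_iff_tendsto_charFun.2 fun t => ?_
    simp only [μ, μ₀, ProbabilityMeasure.coe_mk, charFun_multivariateGaussian
      (posSemidef_covMatrix (hp _) s), charFun_multivariateGaussian (posSemidef_covMatrix hp₀ s),
      dotProduct_covMatrix_mulVec]
    refine (Complex.continuous_exp.tendsto _).comp (tendsto_const_nhds.sub (Tendsto.div_const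
      ((Complex.continuous_ofReal.tendsto _).comp (Tendsto.sub ?_ (Tendsto.pow ?_ 2))) 2))
    · exact tendsto_finsetSum _ fun i _ => (h i i.2).mul_const _
    · exact tendsto_finsetSum _ fun i _ => (h i i.2).mul_const _
  exact ProbabilityMeasure.tendsto_iff_forall_integral_tendsto.1 hμ f

/-- Sequential convergence is turned into a deterministic `δ`, which can be applied to every
empirical pmf close to `p₀`. -/
lemma exists_pos_abs_integral_gaussian_sub_lt {p₀ : ℕ → ℝ} (hp₀ : IsPmf p₀) (f : Vec s →ᵇ ℝ)
    {ε : ℝ} (hε : 0 < ε) : ∃ δ > 0, ∀ p, IsPmf p → (∀ j, |p j - p₀ j| < δ) →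
      |∫ u, f u ∂multivariateGaussian 0 (covMatrix s p) -
        ∫ u, f u ∂multivariateGaussian 0 (covMatrix s p₀)| < ε := by
  by_contra! hcon
  choose p hp hpd hpe using fun n : ℕ => hcon (1 / ((n : ℝ) + 1)) Nat.one_div_pos_of_nat
  have ht : ∀ j < s + 2, Tendsto (fun n => p n j) atTop (𝓝 (p₀ j)) := fun j _ =>
    tendsto_iff_dist_tendsto_zero.2 <| squeeze_zero (fun _ => dist_nonneg)
      (fun n => (hpd n j).le) tendsto_one_div_add_atTop_nhds_zero_nat
  have h := tendsto_integral_gaussian hp hp₀ ht f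
  obtain ⟨n, hn⟩ := (Metric.tendsto_nhds.1 h ε hε).exists
  exact absurd hn (not_lt.2 (hpe n))

end Gaussian

/-! ### Vectors of varying dimension -/

section VarVec

lemma measurable_sigma_mk (s : ℕ) : Measurable fun u : Vec s => (⟨s, u⟩ : VarVec) := by
  intro t ht
  exact (MeasurableSpace.measurableSet_iInf.1 ht) s

lemma measurable_of_sigma {β : Type*} [MeasurableSpace β] {φ : VarVec → β}
    (h : ∀ s, Measurable fun u : Vec s => φ ⟨s, u⟩) : Measurable φ := by
  intro t ht
  exact MeasurableSpace.measurableSet_iInf.2 fun s => h s ht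

/-- The projection of a vector of any dimension onto the vectors that are convex at `A`. -/
noncomputable def projVar (A : Set ℕ) (z : VarVec) : VarVec :=
  ⟨z.1, proj (convexOnPoints z.1 A) z.2⟩

/-- The squared distance of a vector of any dimension to the vectors that are convex at `A`. -/
noncomputable def distVar (A : Set ℕ) (z : VarVec) : ℝ :=
  sqDist (proj (convexOnPoints z.1 A) z.2) z.2

lemma measurable_projVar (A : Set ℕ) : Measurable (projVar A) :=
  measurable_of_sigma fun s => (measurable_sigma_mk s).comp (continuous_proj s A).measurable

lemma measurable_distVar (A : Set ℕ) : Measurable (distVar A) :=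
  measurable_of_sigma fun s => (continuous_sqDist_proj s A).measurable

/-- With countably many samples, measurability is checked one fixed cone at a time; no regularity of
the estimator in the data is needed. -/
lemma measurable_comp_of_countable {Ω E α β : Type*} [MeasurableSpace Ω] [MeasurableSpace E]
    [MeasurableSpace α] [MeasurableSpace β] [Countable E] [MeasurableSingletonClass E]
    {Y : Ω → E} (hY : Measurable Y) {Z : Ω → α} (hZ : Measurable Z) {φ : E → α → β}
    (hφ : ∀ e, Measurable (φ e)) : Measurable fun ω => φ (Y ω) (Z ω) :=
  (measurable_from_prod_countable_right (f := fun q : E × α => φ q.1 q.2) hφ).comp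
    (hY.prodMk hZ)

end VarVec

/-! ### Conditioning on a discrete random variable -/

section Conditioning

lemma integral_cond {Ω : Type*} [MeasurableSpace Ω] (P : Measure Ω) (s : Set Ω) (F : Ω → ℝ) :
    ∫ ω, F ω ∂P[|s] = (P.real s)⁻¹ * ∫ ω in s, F ω ∂P := by
  rw [ProbabilityTheory.cond, integral_smul_measure, ENNReal.toReal_inv, smul_eq_mul]
  rfl

/-- The conditional expectation is a function of `Y`, hence constant on each fibre, and integrating
over the fibre identifies the constant. The null fibres are countably many and are discarded
together. -/
lemma condExp_comap_ae_eq {Ω E : Type*} [MeasurableSpace Ω] {P : Measure Ω}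
    [IsProbabilityMeasure P] [MeasurableSpace E] [Countable E] [MeasurableSingletonClass E]
    {Y : Ω → E} (hY : Measurable Y) {F : Ω → ℝ} (hF : Integrable F P) :
    ∀ᵐ ω ∂P, P (Y ⁻¹' {Y ω}) ≠ 0 ∧
      (P[F | MeasurableSpace.comap Y inferInstance]) ω = ∫ ω', F ω' ∂P[|Y ⁻¹' {Y ω}] := by
  have hm : MeasurableSpace.comap Y inferInstance ≤ (inferInstance : MeasurableSpace Ω) :=
    hY.comap_le
  obtain ⟨h, -, hh⟩ := (stronglyMeasurable_condExp (μ := P) (f := F)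
    (m := MeasurableSpace.comap Y inferInstance)).exists_eq_measurable_comp
  have hnull : ∀ᵐ ω ∂P, P (Y ⁻¹' {Y ω}) ≠ 0 := by
    have : ∀ᵐ ω ∂P, ∀ e, P (Y ⁻¹' {e}) = 0 → Y ω ≠ e := by
      refine ae_all_iff.2 fun e => ?_
      by_cases he : P (Y ⁻¹' {e}) = 0
      · have : ∀ᵐ ω ∂P, ω ∉ Y ⁻¹' {e} := measure_eq_zero_iff_ae_notMem.1 he
        filter_upwards [this] with ω hω _ using hω
      · exact .of_forall fun _ h => absurd h he
    filter_upwards [this] with ω hω h0 using hω _ h0 rfl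
  filter_upwards [hnull] with ω hω
  refine ⟨hω, ?_⟩
  have hset : MeasurableSet (Y ⁻¹' {Y ω}) := hY (measurableSet_singleton _)
  have h1 : ∫ ω' in Y ⁻¹' {Y ω}, (P[F | MeasurableSpace.comap Y inferInstance]) ω' ∂P =
      ∫ ω' in Y ⁻¹' {Y ω}, F ω' ∂P :=
    setIntegral_condExp hm hF ⟨{Y ω}, measurableSet_singleton _, rfl⟩
  have h2 : ∫ ω' in Y ⁻¹' {Y ω}, (P[F | MeasurableSpace.comap Y inferInstance]) ω' ∂P =
      ∫ _ in Y ⁻¹' {Y ω}, h (Y ω) ∂P := by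
    refine setIntegral_congr_fun hset fun ω' hω' => ?_
    simp only [Set.mem_preimage, Set.mem_singleton_iff] at hω'
    rw [hh, Function.comp_apply, hω']
  rw [h2, setIntegral_const, smul_eq_mul] at h1
  have hpos : P.real (Y ⁻¹' {Y ω}) ≠ 0 := by
    rw [measureReal_def]; exact (ENNReal.toReal_pos hω (measure_ne_top _ _)).ne'
  rw [integral_cond, ← h1, inv_mul_cancel_left₀ hpos, hh, Function.comp_apply]

end Conditioning

end ConvexTest

namespace ConvexTest

/-! ### The empirical probability mass function -/

section Empirical

lemma isPmf_empPmf {n : ℕ} (hn : 1 ≤ n) (x : Fin n → ℕ) : IsPmf (empPmf x) := by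
  have hn' : (n : ℝ) ≠ 0 := by positivity
  refine ⟨fun j => mul_nonneg (by positivity) (Finset.sum_nonneg fun i _ => ?_), ?_⟩
  · split_ifs <;> norm_num
  · have h : HasSum (fun j => ∑ i, if x i = j then (1 : ℝ) else 0) (∑ _i : Fin n, (1 : ℝ)) :=
      hasSum_sum fun i _ => by
        have := hasSum_ite_eq (x i) (1 : ℝ)
        simpa only [eq_comm] using this
    have e : (n : ℝ)⁻¹ * ∑ _i : Fin n, (1 : ℝ) = 1 := by simp [hn']
    rw [← e]
    exact h.mul_left _

lemma empPmf_eq_zero {n : ℕ} {x : Fin n → ℕ} {j : ℕ} (h : ∀ i, x i ≠ j) : empPmf x j = 0 := by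
  simp [empPmf, h]

lemma sampleMax_eq {n : ℕ} {x : Fin n → ℕ} {S : ℕ} (hx : ∀ i, x i ≤ S) (h : empPmf x S ≠ 0) :
    sampleMax x = S := by
  refine le_antisymm (Finset.sup_le fun i _ => hx i) ?_
  by_contra! hlt
  refine h (empPmf_eq_zero fun i hi => ?_)
  have : x i ≤ sampleMax x := Finset.le_sup (Finset.mem_univ i)
  omega

/-- When the empirical pmf is close to `p₀`, thresholding recovers the knots of `p₀`. -/
lemma convexOnPoints_convexLSE_eq_coneZero {S : ℕ} {p p₀ : ℕ → ℝ} (hp : IsPmf p) (hp₀ : IsPmf p₀)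
    (hc : IsConvexSeq p₀) {v : ℝ} (hle : ∀ j ≤ S, |p j - p₀ j| ≤ v / (4 * (S + 1)))
    (heq : ∀ j, S < j → p j = p₀ j)
    (hknot : ∀ k ≤ S, IsKnot p₀ k → 2 * v < secondDiff p₀ k) :
    convexOnPoints S {k | secondDiff (convexLSE p) k ≤ v} = coneZero S p₀ := by
  refine convexOnPoints_congr fun k hk1 hkS => ?_
  -- Passing to the estimator costs a factor `S + 1`, and taking second differences a factor 4; this
  -- accounts for the tolerance `v / (4 * (S + 1))`.
  have h : |secondDiff (convexLSE p) k - secondDiff p₀ k| ≤ v := by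
    have := abs_secondDiff_sub_le (abs_convexLSE_sub_le hp hp₀ hc hle heq) k
    have e : 4 * (((S : ℝ) + 1) * (v / (4 * (S + 1)))) = v := by field_simp
    rwa [e] at this
  rw [abs_le] at h
  change secondDiff (convexLSE p) k ≤ v ↔ ¬ IsKnot p₀ k
  by_cases hkn : IsKnot p₀ k
  · have := hknot k hkS hkn
    simp only [hkn, not_true_eq_false, iff_false, not_le]
    linarith
  · have h0 : secondDiff p₀ k ≤ 0 := not_lt.1 fun h => hkn ⟨hk1, h⟩
    simp only [hkn, not_false_eq_true, iff_true]
    linarith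

lemma measurable_sample {Ω : Type*} [MeasurableSpace Ω] {X : ℕ → Ω → ℕ}
    (hX : ∀ i, Measurable (X i)) (n : ℕ) : Measurable (sample X n) :=
  measurable_pi_lambda _ fun i => hX i

lemma ae_forall_le {Ω : Type*} [MeasurableSpace Ω] {P : Measure Ω} [IsProbabilityMeasure P]
    {X : ℕ → Ω → ℕ} {p₀ : ℕ → ℝ} (hXlaw : ∀ i j, P.real (X i ⁻¹' {j}) = p₀ j) {S : ℕ}
    (h0 : ∀ j, S < j → p₀ j = 0) : ∀ᵐ ω ∂P, ∀ i, X i ω ≤ S := by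
  have : ∀ᵐ ω ∂P, ∀ i j, S < j → X i ω ≠ j := by
    refine ae_all_iff.2 fun i => ae_all_iff.2 fun j => ?_
    by_cases hj : S < j
    · have hz : P (X i ⁻¹' {j}) = 0 := by
        have := (hXlaw i j).trans (h0 j hj)
        rwa [measureReal_def, ENNReal.toReal_eq_zero_iff, or_iff_left (measure_ne_top _ _)] at this
      filter_upwards [measure_eq_zero_iff_ae_notMem.1 hz] with ω hω _ using hω
    · exact .of_forall fun _ h => absurd h hj
  filter_upwards [this] with ω hω i
  by_contra! hlt
  exact hω i _ hlt rfl

/-- Chebyshev's inequality for the empirical pmf. -/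
lemma measure_le_abs_empPmf_sub {Ω : Type*} [MeasurableSpace Ω] {P : Measure Ω}
    [IsProbabilityMeasure P] {X : ℕ → Ω → ℕ} (hXm : ∀ i, Measurable (X i))
    (hXindep : iIndepFun X P) {p₀ : ℕ → ℝ} (hXlaw : ∀ i j, P.real (X i ⁻¹' {j}) = p₀ j)
    {n : ℕ} (hn : 1 ≤ n) (j : ℕ) {c : ℝ} (hc : 0 < c) :
    P {ω | c ≤ |empPmf (sample X n ω) j - p₀ j|} ≤ ENNReal.ofReal ((n : ℝ)⁻¹ / c ^ 2) := by
  have hn' : (n : ℝ) ≠ 0 := by positivity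
  let φ : ℕ → ℝ := fun k => if k = j then 1 else 0
  have hφ : Measurable φ := measurable_of_countable φ
  let Y : Fin n → Ω → ℝ := fun i => φ ∘ X i
  have hYm : ∀ i, Measurable (Y i) := fun i => hφ.comp (hXm i)
  have hYb : ∀ i ω, Y i ω = 0 ∨ Y i ω = 1 := fun i ω => by
    by_cases h : X i ω = j <;> simp [Y, φ, h]
  have hY2 : ∀ i, MemLp (Y i) 2 P := fun i =>
    MemLp.of_bound (hYm i).aestronglyMeasurable 1
      (.of_forall fun ω => by rcases hYb i ω with h | h <;> simp [h])
  have hYmean : ∀ i, ∫ ω, Y i ω ∂P = p₀ j := fun i => by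
    have e : Y i = (X i ⁻¹' {j}).indicator 1 := by
      ext ω
      by_cases h : X i ω = j <;> simp [Y, φ, h]
    rw [e, integral_indicator_one (hXm i (measurableSet_singleton j)), hXlaw]
  -- The crude bound by the second moment of an indicator suffices, as only the order of the
  -- variance in `n` matters.
  have hYvar : ∀ i, variance (Y i) P ≤ 1 := fun i => by
    refine (variance_le_expectation_sq (hYm i).aestronglyMeasurable).trans ?_
    have : ∫ ω, (Y i ^ 2) ω ∂P ≤ ∫ _, (1 : ℝ) ∂P := by
      refine integral_mono ((hY2 i).integrable_sq) (integrable_const _) fun ω => ?_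
      rcases hYb i ω with h | h <;> simp [h]
    simpa using this
  have hsum : variance (∑ i, Y i) P ≤ n := by
    rw [IndepFun.variance_sum (fun i _ => hY2 i) fun i _ k _ hik =>
      (hXindep.indepFun (by simpa [Fin.ext_iff] using hik)).comp hφ hφ]
    exact (Finset.sum_le_sum fun i _ => hYvar i).trans (by simp)
  let Z : Ω → ℝ := fun ω => (n : ℝ)⁻¹ * (∑ i, Y i) ω
  have hZ2 : MemLp Z 2 P := (memLp_finsetSum' _ fun i _ => hY2 i).const_mul _
  have hZmean : ∫ ω, Z ω ∂P = p₀ j := by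
    simp only [Z, Finset.sum_apply]
    rw [integral_const_mul, integral_finsetSum _ fun i _ => (hY2 i).integrable one_le_two]
    simp [hYmean, hn']
  have hZvar : variance Z P ≤ (n : ℝ)⁻¹ := by
    rw [variance_const_mul]
    calc (n : ℝ)⁻¹ ^ 2 * variance (∑ i, Y i) P ≤ (n : ℝ)⁻¹ ^ 2 * n := by gcongr
      _ = (n : ℝ)⁻¹ := by field_simp
  have hZ : ∀ ω, empPmf (sample X n ω) j = Z ω := fun ω => by
    simp only [Z, Finset.sum_apply]; rfl
  simp only [hZ]
  have h := meas_ge_le_variance_div_sq hZ2 hc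
  rw [hZmean] at h
  exact h.trans (ENNReal.ofReal_le_ofReal (by gcongr))

end Empirical

end ConvexTest

/-! ### Conditional law of the test statistic and its limit -/

namespace ConvexTest

/-- The conditional expectation of a function of the test statistic, given data whose sample
maximum is `S`, is a Gaussian integral. -/
lemma integral_cond_distVar {Ω : Type*} [MeasurableSpace Ω] {P : Measure Ω} {n : ℕ}
    {Y : Ω → Fin n → ℕ} (hY : Measurable Y) {G : Ω → VarVec} (hG : Measurable G)
    {x : Fin n → ℕ} {p : ℕ → ℝ}
    (hlaw : (P[|Y ⁻¹' {x}]).map G =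
      (multivariateGaussian 0 (covMatrix (sampleMax x) p)).map fun u => (⟨_, u⟩ : VarVec))
    {S : ℕ} (hS : sampleMax x = S) (A : (Fin n → ℕ) → Set ℕ) (f : ℝ →ᵇ ℝ) :
    ∫ ω, f (distVar (A (Y ω)) (G ω)) ∂P[|Y ⁻¹' {x}] =
      ∫ u, f (sqDist (proj (convexOnPoints S (A x)) u) u)
        ∂multivariateGaussian 0 (covMatrix S p) := by
  -- The dimension is part of the type of the vectors, so `S` has to become `sampleMax x` before the
  -- laws can be compared.
  subst hS
  have hset : MeasurableSet (Y ⁻¹' {x}) := hY (measurableSet_singleton _)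
  have hm : Measurable fun z => f (distVar (A x) z) :=
    f.continuous.measurable.comp (measurable_distVar _)
  calc ∫ ω, f (distVar (A (Y ω)) (G ω)) ∂P[|Y ⁻¹' {x}]
      = ∫ ω, f (distVar (A x) (G ω)) ∂P[|Y ⁻¹' {x}] := by
        refine integral_congr_ae ?_
        filter_upwards [ProbabilityTheory.ae_cond_mem hset] with ω hω
        rw [show Y ω = x from hω]
    _ = ∫ z, f (distVar (A x) z) ∂(P[|Y ⁻¹' {x}]).map G :=
        (integral_map hG.aemeasurable hm.aestronglyMeasurable).symm
    _ = _ := by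
        rw [hlaw, integral_map (measurable_sigma_mk _).aemeasurable hm.aestronglyMeasurable]
        rfl

/-- Chebyshev bounds at the scale of the thresholds vanish. -/
lemma tendsto_inv_div_sq {v : ℕ → ℝ}
    (hv : (fun n : ℕ => (n : ℝ) ^ (-(1 / 2) : ℝ)) =o[atTop] v) (b : ℝ) :
    Tendsto (fun n : ℕ => (n : ℝ)⁻¹ / (v n / b) ^ 2) atTop (𝓝 0) := by
  have h := (hv.tendsto_div_nhds_zero.pow 2).mul_const (b ^ 2)
  rw [zero_pow two_ne_zero, zero_mul] at h
  refine h.congr fun n => ?_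
  have e : ((n : ℝ) ^ (-(1 / 2) : ℝ)) ^ 2 = (n : ℝ)⁻¹ := by
    rw [← Real.rpow_natCast, ← Real.rpow_mul (Nat.cast_nonneg n)]
    norm_num [Real.rpow_neg_one]
  rw [div_pow, div_pow, e, div_div_eq_mul_div, div_mul_eq_mul_div]

/-- A positive lower bound for the second differences at the knots up to `S`. -/
lemma exists_pos_lt_secondDiff (p : ℕ → ℝ) (S : ℕ) :
    ∃ η > 0, ∀ k ≤ S, IsKnot p k → η < secondDiff p k := by
  induction S with
  | zero => exact ⟨1, one_pos, fun k hk h => absurd h.1 (by omega)⟩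
  | succ S ih =>
    obtain ⟨η, hη, h⟩ := ih
    by_cases hk : IsKnot p (S + 1)
    · refine ⟨min η (secondDiff p (S + 1) / 2), lt_min hη (half_pos hk.2), fun k hkS hkn => ?_⟩
      rcases hkS.eq_or_lt with rfl | hlt
      · exact (min_le_right _ _).trans_lt (half_lt_self hk.2)
      · exact (min_le_left _ _).trans_lt (h k (by omega) hkn)
    · refine ⟨η, hη, fun k hkS hkn => h k ?_ hkn⟩
      rcases hkS.eq_or_lt with rfl | hlt
      · exact absurd hkn hk
      · omega

/-- Given data close to `p₀`, the conditional expectation of a function of the test statistic is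
close to its limit. -/
lemma exists_pos_abs_integral_proj_sub_lt {S : ℕ} {p₀ : ℕ → ℝ} (hp₀ : IsPmf p₀)
    (hc : IsConvexSeq p₀) (hsupp : Function.support p₀ = Set.Iic S) (f : ℝ →ᵇ ℝ) {ε : ℝ}
    (hε : 0 < ε) : ∃ η > 0, ∀ v, 0 < v → v < η → ∀ n, 1 ≤ n → ∀ x : Fin n → ℕ, (∀ i, x i ≤ S) →
      (∀ j ≤ S, |empPmf x j - p₀ j| < v / (4 * (S + 1))) → sampleMax x = S ∧
      |∫ u, f (sqDist (proj (convexOnPoints S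
          {k | secondDiff (convexLSE (empPmf x)) k ≤ v}) u) u)
            ∂multivariateGaussian 0 (covMatrix S (empPmf x)) -
        ∫ u, f (sqDist (proj (coneZero S p₀) u) u)
            ∂multivariateGaussian 0 (covMatrix S p₀)| < ε := by
  let F : Vec S →ᵇ ℝ := f.compContinuous
    ⟨fun u => sqDist (proj (coneZero S p₀) u) u, continuous_sqDist_proj S _⟩
  obtain ⟨δ, hδ, hF⟩ := exists_pos_abs_integral_gaussian_sub_lt hp₀ F hε
  obtain ⟨η, hη, hknot⟩ := exists_pos_lt_secondDiff p₀ S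
  have hpS : 0 < p₀ S := (hp₀.1 S).lt_of_ne'
    (show S ∈ Function.support p₀ by rw [hsupp]; exact le_refl S)
  -- Below `δ` the Gaussian integrals are close; below `p₀ S` the value `S` must have been observed;
  -- below `η / 2` the threshold separates knots from non-knots.
  refine ⟨min (min δ (p₀ S)) (η / 2), by positivity, fun v hv hvη n hn x hx hclose => ?_⟩
  have hvδ : v < δ := hvη.trans_le ((min_le_left _ _).trans (min_le_left _ _))
  have hvp : v < p₀ S := hvη.trans_le ((min_le_left _ _).trans (min_le_right _ _))
  have hvk : v < η / 2 := hvη.trans_le (min_le_right _ _)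
  have hvle : v / (4 * (S + 1)) ≤ v := div_le_self hv.le (by
    have : (0 : ℝ) ≤ S := Nat.cast_nonneg S
    linarith)
  have hp := isPmf_empPmf hn x
  have heq : ∀ j, S < j → empPmf x j = p₀ j := fun j hj => by
    have h0 : p₀ j = 0 := by
      rw [← Function.notMem_support, hsupp]; exact not_le.2 hj
    rw [h0, empPmf_eq_zero fun i => ((hx i).trans_lt hj).ne]
  refine ⟨sampleMax_eq hx fun h0 => ?_, ?_⟩
  · have := hclose S le_rfl
    rw [h0, zero_sub, abs_neg, abs_of_pos hpS] at this
    linarith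
  · rw [convexOnPoints_convexLSE_eq_coneZero hp hp₀ hc (fun j hj => (hclose j hj).le) heq
      fun k hk hkn => by linarith [hknot k hk hkn]]
    refine hF _ hp fun j => ?_
    rcases le_or_gt j S with hj | hj
    · exact (hclose j hj).trans_le (hvle.trans hvδ.le)
    · rw [heq j hj, sub_self, abs_zero]; exact hδ

end ConvexTest

theorem theorem2
    {Ω : Type*} [MeasurableSpace Ω] (P : Measure Ω) [IsProbabilityMeasure P]
    {Ω₀ : Type*} [MeasurableSpace Ω₀] (P₀ : Measure Ω₀) [IsProbabilityMeasure P₀]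
    -- the true pmf, with support `{0, …, S}`
    (S : ℕ) (hS : 0 < S) (p₀ : ℕ → ℝ) (hp₀ : ConvexTest.IsPmf p₀)
    (hsupp : Function.support p₀ = Set.Iic S)
    -- i.i.d. observations from `p₀`
    (X : ℕ → Ω → ℕ) (hXm : ∀ i, Measurable (X i)) (hXindep : iIndepFun X P)
    (hXlaw : ∀ i j, P.real (X i ⁻¹' {j}) = p₀ j)
    -- the thresholds
    (v : ℕ → ℝ) (hvpos : ∀ n, 1 ≤ n → 0 < v n) (hv0 : Tendsto v atTop (𝓝 0))
    (hv : (fun n : ℕ => (n : ℝ) ^ (-(1 / 2) : ℝ)) =o[atTop] v)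
    -- the limiting Gaussian vector
    (g₀ : Ω₀ → ConvexTest.Vec S)
    (hg₀ : HasLaw g₀ (multivariateGaussian 0 (ConvexTest.covMatrix S p₀)) P₀)
    -- random vectors of dimension `S_n + 2` that are Gaussian conditionally on the data
    (g : (n : ℕ) → (ω : Ω) →
      ConvexTest.Vec (ConvexTest.sampleMax (ConvexTest.sample X n ω)))
    (hgm : ∀ n, 1 ≤ n → Measurable (fun ω => (⟨_, g n ω⟩ : ConvexTest.VarVec)))
    (hglaw : ∀ n, 1 ≤ n → ∀ x : Fin n → ℕ, P (ConvexTest.sample X n ⁻¹' {x}) ≠ 0 →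
      (P[|ConvexTest.sample X n ⁻¹' {x}]).map (fun ω => (⟨_, g n ω⟩ : ConvexTest.VarVec)) =
        (multivariateGaussian 0
          (ConvexTest.covMatrix (ConvexTest.sampleMax x) (ConvexTest.empPmf x))).map
            (fun u => (⟨_, u⟩ : ConvexTest.VarVec))) :
    -- existence and uniqueness of the projection
    (∀ n, 1 ≤ n → ∀ ω, ∃! h,
      ConvexTest.IsProj (ConvexTest.coneEmp (v n) (ConvexTest.sample X n ω)) (g n ω) h) ∧
    -- measurability of the projection and of the squared distance
    (∀ n, 1 ≤ n → Measurable (fun ω =>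
      (⟨_, ConvexTest.proj (ConvexTest.coneEmp (v n) (ConvexTest.sample X n ω)) (g n ω)⟩ :
        ConvexTest.VarVec))) ∧
    (∀ n, 1 ≤ n → Measurable (fun ω => ConvexTest.sqDist
      (ConvexTest.proj (ConvexTest.coneEmp (v n) (ConvexTest.sample X n ω)) (g n ω)) (g n ω))) ∧
    -- conditional convergence in distribution, in probability, when `p₀` is convex on `ℕ`
    (ConvexTest.IsConvexSeq p₀ → ConvexTest.CondTendstoInDistribution P P₀
      (fun n => MeasurableSpace.comap (ConvexTest.sample X n) inferInstance)
      (fun n ω => ConvexTest.sqDist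
        (ConvexTest.proj (ConvexTest.coneEmp (v n) (ConvexTest.sample X n ω)) (g n ω)) (g n ω))
      (fun ω => ConvexTest.sqDist
        (ConvexTest.proj (ConvexTest.coneZero S p₀) (g₀ ω)) (g₀ ω))) := by
  have hYm : ∀ n, Measurable (ConvexTest.sample X n) := ConvexTest.measurable_sample hXm
  let A : (n : ℕ) → (Fin n → ℕ) → Set ℕ := fun n x =>
    {k | ConvexTest.secondDiff (ConvexTest.convexLSE (ConvexTest.empPmf x)) k ≤ v n}
  have hTm : ∀ n, 1 ≤ n → Measurable fun ω =>
      ConvexTest.distVar (A n (ConvexTest.sample X n ω)) ⟨_, g n ω⟩ := fun n hn =>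
    ConvexTest.measurable_comp_of_countable (hYm n) (hgm n hn)
      fun x => ConvexTest.measurable_distVar (A n x)
  refine ⟨fun n _ ω => ConvexTest.existsUnique_isProj _ _, fun n hn =>
    ConvexTest.measurable_comp_of_countable (hYm n) (hgm n hn)
      fun x => ConvexTest.measurable_projVar (A n x), hTm, fun hconv f => ?_⟩
  have hlim : ∫ ω, f (ConvexTest.sqDist (ConvexTest.proj (ConvexTest.coneZero S p₀) (g₀ ω))
      (g₀ ω)) ∂P₀ = ∫ u, f (ConvexTest.sqDist (ConvexTest.proj (ConvexTest.coneZero S p₀) u) u)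
        ∂multivariateGaussian 0 (ConvexTest.covMatrix S p₀) := by
    rw [← hg₀.map_eq, integral_map hg₀.aemeasurable]
    exact (f.continuous.comp
      (ConvexTest.continuous_sqDist_proj S _)).measurable.aestronglyMeasurable
  rw [tendstoInMeasure_iff_dist]
  intro ε hε
  obtain ⟨η, hη, hgood⟩ :=
    ConvexTest.exists_pos_abs_integral_proj_sub_lt hp₀ hconv hsupp f hε
  have hle : ∀ᵐ ω ∂P, ∀ i, X i ω ≤ S := ConvexTest.ae_forall_le hXlaw fun j hj => by
    rw [← Function.notMem_support, hsupp]; exact not_le.2 hj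
  have hbound : Tendsto (fun n : ℕ => ∑ _j ∈ Finset.range (S + 1),
      ENNReal.ofReal ((n : ℝ)⁻¹ / (v n / (4 * (S + 1))) ^ 2)) atTop (𝓝 0) := by
    have h := ENNReal.tendsto_ofReal (ConvexTest.tendsto_inv_div_sq hv (4 * (S + 1)))
    rw [ENNReal.ofReal_zero] at h
    simpa using tendsto_finsetSum (Finset.range (S + 1)) fun _ _ => h
  refine tendsto_of_tendsto_of_tendsto_of_le_of_le' tendsto_const_nhds hbound
    (.of_forall fun _ => zero_le) ?_
  filter_upwards [eventually_ge_atTop 1, hv0.eventually_lt_const hη] with n hn hvn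
  have hvp := hvpos n hn
  have hint : Integrable (fun ω => f (ConvexTest.distVar (A n (ConvexTest.sample X n ω))
      ⟨_, g n ω⟩)) P :=
    .of_bound (f.continuous.measurable.comp (hTm n hn)).aestronglyMeasurable ‖f‖
      (.of_forall fun ω => f.norm_coe_le_norm _)
  have hcond := ConvexTest.condExp_comap_ae_eq (hYm n) hint
  -- Almost surely, a deviation of at least `ε` forces some coordinate `j ≤ S` of the empirical pmf
  -- to miss the tolerance, so a union bound over Chebyshev events applies.
  refine le_trans (measure_mono_ae ?_) ((measure_biUnion_finset_le (Finset.range (S + 1))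
    fun j => {ω | v n / (4 * (S + 1)) ≤
      |ConvexTest.empPmf (ConvexTest.sample X n ω) j - p₀ j|}).trans (Finset.sum_le_sum fun j _ =>
        ConvexTest.measure_le_abs_empPmf_sub hXm hXindep hXlaw hn j (by positivity)))
  filter_upwards [hle, hcond] with ω hω hcω hbad
  by_contra hnot
  have hclose : ∀ j ≤ S, |ConvexTest.empPmf (ConvexTest.sample X n ω) j - p₀ j| <
      v n / (4 * (S + 1)) := by
    intro j hj
    by_contra! hcon
    exact hnot (Set.mem_biUnion (Finset.mem_coe.2 (Finset.mem_range.2 (Nat.lt_succ_of_le hj))) hcon)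
  obtain ⟨hmax, hlt⟩ := hgood (v n) hvp hvn n hn (ConvexTest.sample X n ω) (fun i => hω i) hclose
  rw [← ConvexTest.integral_cond_distVar (hYm n) (hgm n hn) (hglaw n hn _ hcω.1) hmax (A n) f,
    ← hcω.2, ← hlim, ← Real.dist_eq] at hlt
  exact absurd hlt (not_lt.2 hbad)
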